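/- Let $n, k, r$ be integers with $n \ge 1$, $0 \le k \le n$ and $r \ge 1$. For $0 \le d \le n$ put $e_d(\mathbf{x}_n^r) := \sum_{1 \le j_1 < \cdots < j_d \le n} x_{j_1}^r \cdots x_{j_d}^r \in \mathbb{C}[x_1,\dots,x_n]$, and let $$S_{n,k} := \mathbb{C}[x_1,\dots,x_n]/J_{n,k}, \qquad J_{n,k} := \langle x_1^{kr}, \dots, x_n^{kr},\ e_n(\mathbf{x}_n^r), e_{n-1}(\mathbf{x}_n^r), \dots, e_{n-k+1}(\mathbf{x}_n^r) \rangle .$$ Let $G_n$ be the set of $r$-colored permutations $g = \pi_1^{c_1} \cdots \pi_n^{c_n}$, where $\pi_1 \cdots \pi_n$ is a permutation of $\{1,\dots,n\}$ and $c_1,\dots,c_n \in \{0,1,\dots,r-1\}$. Order colored letters by $a^c < b^d$ if and only if $c > d$, or $c = d$ and $a < b$. Let $\mathrm{Des}(g) := \{1 \le i \le n-1 : \pi_i^{c_i} > \pi_{i+1}^{c_{i+1}}\}$, $\mathrm{des}(g) := |\mathrm{Des}(g)|$, $d_i(g) := |\{j \in \mathrm{Des}(g) : j \ge i\}|$, and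 let $$b_g := \prod_{i=1}^n x_{\pi_i}^{r d_i(g) + c_i}$$ be the Bango–Biagioli descent monomial of $g$. Let $\mathcal{D}_{n,k}$ be the set of all monomials of the form $$b_g \cdot x_{\pi_1}^{r i_1} \cdots x_{\pi_{n-k}}^{r i_{n-k}},$$ where $g = \pi_1^{c_1}\cdots\pi_n^{c_n} \in G_n$ satisfies $\mathrm{des}(g) < k$ and the integers $i_1, \dots, i_{n-k}$ satisfy $k - \mathrm{des}(g) > i_1 \ge \cdots \ge i_{n-k} \ge 0$. **Theorem.** The set $\mathcal{D}_{n,k}$ of $(n,k)$-descent monomials descends to a basis of the complex vector space $S_{n,k}$; that is, the residue classes modulo $J_{n,k}$ of the elements of $\mathcal{D}_{n,k}$ are pairwise distinct and form a $\mathbb{C}$-basis of $S_{n,k}$. -/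

import Mathlib

open MvPolynomial

namespace DescentBasis

/-- The `d`-th elementary symmetric polynomial in the variable powers,
`e_d(x_1^r, …, x_n^r) ∈ ℂ[x_1, …, x_n]`. -/
noncomputable def esymmPow (n r d : ℕ) : MvPolynomial (Fin n) ℂ :=
  ∑ t ∈ Finset.powersetCard d Finset.univ, ∏ i ∈ t, X i ^ r

/-- The ideal `J_{n,k} = ⟨x_1^{kr}, …, x_n^{kr}, e_n(x^r), e_{n-1}(x^r), …, e_{n-k+1}(x^r)⟩`
(for `k ≤ n`). -/
noncomputable def idealJ (n k r : ℕ) : Ideal (MvPolynomial (Fin n) ℂ) :=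
  Ideal.span
    ({p | ∃ i : Fin n, p = X i ^ (k * r)} ∪
      {p | ∃ d : ℕ, n - k + 1 ≤ d ∧ d ≤ n ∧ p = esymmPow n r d})

/-- The quotient ring `S_{n,k} = ℂ[x_1, …, x_n] / J_{n,k}`. -/
abbrev QuotS (n k r : ℕ) : Type :=
  MvPolynomial (Fin n) ℂ ⧸ idealJ n k r

/-- An `r`-colored permutation `g = π_1^{c_1} … π_n^{c_n}`, that is, an element of `G_n`:
a permutation `π` together with a color `c_i ∈ {0, …, r-1}` for each position `i`.
Positions and letters are `0, …, n-1` here. -/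
structure ColoredPerm (n r : ℕ) where
  perm : Equiv.Perm (Fin n)
  color : Fin n → Fin r

/-- The order `<` on colored letters `a^c`, in which colors weigh more than letter values and
higher colors are smaller: `a^c < b^d` iff `c > d`, or `c = d` and `a < b`. -/
def LetterLT {n r : ℕ} (x y : Fin n × Fin r) : Prop :=
  y.2 < x.2 ∨ (x.2 = y.2 ∧ x.1 < y.1)

instance {n r : ℕ} (x y : Fin n × Fin r) : Decidable (LetterLT x y) :=
  inferInstanceAs (Decidable (y.2 < x.2 ∨ (x.2 = y.2 ∧ x.1 < y.1)))

namespace ColoredPerm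

variable {n r : ℕ}

/-- The colored letter `π_i^{c_i}` in position `i`. -/
def letter (g : ColoredPerm n r) (i : Fin n) : Fin n × Fin r :=
  (g.perm i, g.color i)

/-- The descent set: the positions `i`, other than the last one, with
`π_i^{c_i} > π_{i+1}^{c_{i+1}}`. -/
def Des (g : ColoredPerm n r) : Finset (Fin n) :=
  Finset.univ.filter fun i =>
    ∃ h : i.val + 1 < n, LetterLT (g.letter ⟨i.val + 1, h⟩) (g.letter i)

/-- The number of descents. -/
def des (g : ColoredPerm n r) : ℕ := g.Des.card

/-- `d_i(g)`, the number of descents `j` of `g` with `j ≥ i`. -/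
def dseq (g : ColoredPerm n r) (i : Fin n) : ℕ :=
  (g.Des.filter fun j => i ≤ j).card

/-- The descent monomial `b_g = ∏_i x_{π_i}^{r d_i(g) + c_i}`. -/
noncomputable def descentMonomial (g : ColoredPerm n r) : MvPolynomial (Fin n) ℂ :=
  ∏ i : Fin n, X (g.perm i) ^ (r * g.dseq i + (g.color i).val)

end ColoredPerm

/-- The set `D_{n,k}` of `(n,k)`-descent monomials (for `k ≤ n`): all
`b_g · x_{π_1}^{r i_1} ⋯ x_{π_{n-k}}^{r i_{n-k}}` with `des(g) < k` and
`k - des(g) > i_1 ≥ ⋯ ≥ i_{n-k} ≥ 0`. -/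
def descentMonomials (n k r : ℕ) : Set (MvPolynomial (Fin n) ℂ) :=
  {m | ∃ (g : ColoredPerm n r) (e : Fin (n - k) → ℕ),
    g.des < k ∧ Antitone e ∧ (∀ j, e j < k - g.des) ∧
    m = g.descentMonomial *
      ∏ j : Fin (n - k), X (g.perm (Fin.castLE (Nat.sub_le n k) j)) ^ (r * e j)}

end DescentBasis

namespace DescentBasis

/-! Spanning comes from straightening, independence from evaluation at a finite set of points (orbit
harmonics).

Straightening (`monomial_mem_descentDegree_sup`): a monomial with some exponent at least `k * r`
lies in `J`. Any other monomial outside `D_{n,k}` is the leading term of a monomial multiple of some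
`e_d(x^r)` with `d ≥ n - k + 1` (`exists_leading_set`). The other terms have the same degree and
smaller `potential`, so induction writes every monomial, degree by degree, as descent monomials plus
an element of `J`.

Points: take all `x` with `x_j = (f j + 1) ω ^ c j`, where `c` is any coloring and `f` any
surjection onto `k` blocks. On them each generator of `J` agrees with a polynomial of lower degree
(`generator_agrees`). Repeated straightening therefore shows that the evaluated descent monomials
span all functions on the points. There are at most as many descent monomials as points
(`exists_injective_pointIndex`), so the evaluations are independent.

Transfer to the quotient: a relation modulo `J` can be taken homogeneous of degree `e`. On the
points its left side equals a combination of descent monomials of degree less than `e`, so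
independence of the evaluations kills its coefficients. -/

/-! ### Counting: colored permutations with marked ascents as colored ordered set partitions -/

/-- The sort key of a letter: colored letters are compared by `LetterLT`, after comparing a
block number. -/
def blockKey {n r : ℕ} (b : ℕ) (x : Fin n × Fin r) : ℕ ×ₗ ((Fin r)ᵒᵈ ×ₗ Fin n) :=
  toLex (b, toLex (OrderDual.toDual x.2, x.1))

lemma blockKey_lt_of_lt {n r : ℕ} {b b' : ℕ} (h : b < b') (x y : Fin n × Fin r) :
    blockKey b x < blockKey b' y := by
  rw [blockKey, blockKey, Prod.Lex.toLex_lt_toLex]; exact Or.inl h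

lemma blockKey_lt_of_letterLT {n r : ℕ} (b : ℕ) {x y : Fin n × Fin r} (h : LetterLT x y) :
    blockKey b x < blockKey b y := by
  rw [blockKey, blockKey, Prod.Lex.toLex_lt_toLex]
  refine Or.inr ⟨rfl, ?_⟩
  rw [Prod.Lex.toLex_lt_toLex]
  rcases h with h | ⟨h, h'⟩
  · exact Or.inl (OrderDual.toDual_lt_toDual.2 h)
  · exact Or.inr ⟨by simp [h], h'⟩

lemma letterLT_or_of_ne {n r : ℕ} {x y : Fin n × Fin r} (h : x.1 ≠ y.1) :
    LetterLT x y ∨ LetterLT y x := by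
  unfold LetterLT
  rcases lt_trichotomy x.2 y.2 with h2 | h2 | h2
  · tauto
  · rcases lt_or_gt_of_ne h with h3 | h3
    · exact Or.inl (Or.inr ⟨h2, h3⟩)
    · exact Or.inr (Or.inr ⟨h2.symm, h3⟩)
  · tauto

namespace ColoredPerm

variable {n r : ℕ}

@[ext] lemma ext' {g h : ColoredPerm n r} (h1 : g.perm = h.perm) (h2 : g.color = h.color) :
    g = h := by
  cases g; cases h; simp_all

/-- The ascent set: the positions, other than the last one, that are not descents. -/
def asc (g : ColoredPerm n r) : Finset (Fin n) :=
  Finset.univ.filter fun i => i.val + 1 < n ∧ i ∉ g.Des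

lemma mem_Des {g : ColoredPerm n r} {i : Fin n} :
    i ∈ g.Des ↔ ∃ h : i.val + 1 < n, LetterLT (g.letter ⟨i.val + 1, h⟩) (g.letter i) := by
  simp [Des]

lemma mem_asc {g : ColoredPerm n r} {i : Fin n} :
    i ∈ g.asc ↔ i.val + 1 < n ∧ i ∉ g.Des := by
  simp [asc]

lemma letterLT_of_notMem_Des {g : ColoredPerm n r} {i : Fin n} (h : i.val + 1 < n)
    (hi : i ∉ g.Des) : LetterLT (g.letter i) (g.letter ⟨i.val + 1, h⟩) := by
  have hne : (g.letter i).1 ≠ (g.letter ⟨i.val + 1, h⟩).1 := by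
    intro h'
    have := congrArg Fin.val (g.perm.injective h')
    simp at this
  rcases letterLT_or_of_ne hne with h' | h'
  · exact h'
  · exact absurd (mem_Des.2 ⟨h, h'⟩) hi

lemma card_asc (g : ColoredPerm n r) : g.asc.card = n - 1 - g.des := by
  have hdisj : Disjoint g.asc g.Des := by
    rw [Finset.disjoint_left]
    intro i hi hi'
    exact (mem_asc.1 hi).2 hi'
  have hun : g.asc ∪ g.Des = Finset.univ.filter fun i : Fin n => i.val + 1 < n := by
    ext i
    simp only [Finset.mem_union, mem_asc, Finset.mem_filter, Finset.mem_univ, true_and]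
    constructor
    · rintro (h | h)
      · exact h.1
      · exact (mem_Des.1 h).1
    · intro h
      by_cases h' : i ∈ g.Des <;> tauto
  have hcard : (Finset.univ.filter fun i : Fin n => i.val + 1 < n).card = n - 1 := by
    have : (Finset.univ.filter fun i : Fin n => i.val + 1 < n).map Fin.valEmbedding
        = Finset.range (n - 1) := by
      ext j
      simp only [Finset.mem_map, Finset.mem_filter, Finset.mem_univ, true_and,
        Fin.valEmbedding_apply, Finset.mem_range]
      constructor
      · rintro ⟨i, hi, rfl⟩; omega
      · intro hj; exact ⟨⟨j, by omega⟩, by simp; omega, rfl⟩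
    rw [← Finset.card_map, this, Finset.card_range]
  have := Finset.card_union_of_disjoint hdisj
  rw [hun, hcard] at this
  unfold des
  omega

/-- The block number of a position, if a set `T` of positions is marked as joined to the next
position. -/
def block (T : Finset (Fin n)) (i : ℕ) : ℕ :=
  (Finset.univ.filter fun j : Fin n => j.val < i ∧ j ∉ T).card

lemma block_zero (T : Finset (Fin n)) : block T 0 = 0 := by simp [block]

lemma block_succ (T : Finset (Fin n)) (i : Fin n) :
    block T (i.val + 1) = block T i.val + if i ∈ T then 0 else 1 := by
  unfold block
  split_ifs with h
  · rw [add_zero]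
    congr 1
    ext j
    simp only [Finset.mem_filter, Finset.mem_univ, true_and]
    constructor
    · rintro ⟨h1, h2⟩
      refine ⟨?_, h2⟩
      rcases Nat.lt_succ_iff_lt_or_eq.1 h1 with h3 | h3
      · exact h3
      · exact absurd (Fin.ext h3 ▸ h) h2
    · rintro ⟨h1, h2⟩; exact ⟨by omega, h2⟩
  · have : (Finset.univ.filter fun j : Fin n => j.val < i.val + 1 ∧ j ∉ T)
        = insert i (Finset.univ.filter fun j : Fin n => j.val < i.val ∧ j ∉ T) := by
      ext j
      simp only [Finset.mem_filter, Finset.mem_univ, true_and, Finset.mem_insert]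
      constructor
      · rintro ⟨h1, h2⟩
        rcases Nat.lt_succ_iff_lt_or_eq.1 h1 with h3 | h3
        · exact Or.inr ⟨h3, h2⟩
        · exact Or.inl (Fin.ext h3)
      · rintro (rfl | ⟨h1, h2⟩)
        · exact ⟨by omega, h⟩
        · exact ⟨by omega, h2⟩
    rw [this, Finset.card_insert_of_notMem (by simp)]

lemma block_mono (T : Finset (Fin n)) : Monotone (block T) := by
  intro i j hij
  apply Finset.card_le_card
  intro x
  simp only [Finset.mem_filter, Finset.mem_univ, true_and]
  rintro ⟨h1, h2⟩
  exact ⟨by omega, h2⟩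

/-- A discrete intermediate value argument: block numbers start at 0 and rise by at most one per
step. -/
lemma exists_block_eq (T : Finset (Fin n)) (i : ℕ) (hi : i < n) (b : ℕ) (hb : b ≤ block T i) :
    ∃ j : Fin n, block T j.val = b := by
  induction i with
  | zero =>
    rw [block_zero] at hb
    exact ⟨⟨0, hi⟩, by simp [block_zero]; omega⟩
  | succ i ih =>
    have h := block_succ T ⟨i, by omega⟩
    simp only at h
    by_cases hb' : b ≤ block T i
    · exact ih (by omega) hb'
    · refine ⟨⟨i + 1, hi⟩, ?_⟩
      simp only
      split_ifs at h <;> omega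

lemma block_last {g : ColoredPerm n r} {T : Finset (Fin n)} (hT : T ⊆ g.asc) (hn : 1 ≤ n) :
    block T (n - 1) + T.card + 1 = n := by
  have h1 : (Finset.univ.filter fun j : Fin n => j.val < n - 1 ∧ j ∉ T) ∪ T
      = Finset.univ.erase ⟨n - 1, by omega⟩ := by
    ext j
    simp only [Finset.mem_union, Finset.mem_filter, Finset.mem_univ, true_and, Finset.mem_erase,
      and_true, ne_eq, Fin.ext_iff]
    constructor
    · rintro (h | h)
      · omega
      · have := (mem_asc.1 (hT h)).1
        omega
    · intro h
      have := j.isLt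
      by_cases hj : j ∈ T
      · exact Or.inr hj
      · exact Or.inl ⟨by omega, hj⟩
  have h2 : Disjoint (Finset.univ.filter fun j : Fin n => j.val < n - 1 ∧ j ∉ T) T := by
    rw [Finset.disjoint_left]
    intro j hj
    simp only [Finset.mem_filter] at hj
    exact hj.2.2
  have h3 := Finset.card_union_of_disjoint h2
  rw [h1, Finset.card_erase_of_mem (Finset.mem_univ _), Finset.card_univ, Fintype.card_fin] at h3
  unfold block
  omega

/-- Marked positions are ascents, so letters increase inside a block; at an unmarked position the
block number itself goes up. -/
lemma strictMono_blockKey {g : ColoredPerm n r} {T : Finset (Fin n)} (hT : T ⊆ g.asc) :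
    StrictMono fun i : Fin n => blockKey (block T i.val) (g.letter i) := by
  cases n with
  | zero => intro i; exact i.elim0
  | succ n =>
    rw [Fin.strictMono_iff_lt_succ]
    intro i
    have h := block_succ T i.castSucc
    simp only [Fin.val_castSucc, Fin.val_succ] at h ⊢
    split_ifs at h with hi
    · rw [h, add_zero]
      exact blockKey_lt_of_letterLT _
        (letterLT_of_notMem_Des (by simp) (mem_asc.1 (hT hi)).2)
    · exact blockKey_lt_of_lt (by omega) _ _

/-- The color of each letter. -/
def letterColor (g : ColoredPerm n r) (j : Fin n) : Fin r := g.color (g.perm.symm j)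

/-- The block number of each letter. -/
def letterBlock (g : ColoredPerm n r) (T : Finset (Fin n)) (j : Fin n) : ℕ :=
  block T (g.perm.symm j).val

/-- Colors and blocks fix the key of every letter, and the permutation must list the letters in
increasing key order, which happens in only one way. The marked set is then read off from where the
block number fails to jump. -/
lemma eq_of_letterColor_letterBlock {g g' : ColoredPerm n r} {T T' : Finset (Fin n)}
    (hT : T ⊆ g.asc) (hT' : T' ⊆ g'.asc) (hc : g.letterColor = g'.letterColor)
    (hb : g.letterBlock T = g'.letterBlock T') : g = g' ∧ T = T' := by
  have key : ∀ (g : ColoredPerm n r) (T : Finset (Fin n)),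
      (fun i : Fin n => blockKey (block T i.val) (g.letter i))
        = (fun j => blockKey (g.letterBlock T j) (j, g.letterColor j)) ∘ g.perm := by
    intro g T
    funext i
    simp [letterBlock, letterColor, letter]
  have h1 := strictMono_blockKey hT
  have h2 := strictMono_blockKey hT'
  rw [key] at h1 h2
  rw [← hc, ← hb] at h2
  have hr := (StrictMono.range_inj h1 h2).1 (by
    rw [Set.range_comp, Set.range_comp, g.perm.surjective.range_eq, g'.perm.surjective.range_eq])
  have hp : g.perm = g'.perm := by
    refine Equiv.ext fun i => ?_
    have := congrFun hr i
    simp only [Function.comp, blockKey, EmbeddingLike.apply_eq_iff_eq, Prod.mk.injEq] at this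
    exact this.2.2
  have hcol : g.color = g'.color := by
    funext i
    have := congrFun hc (g.perm i)
    simp only [letterColor, Equiv.symm_apply_apply] at this
    rw [hp] at this
    simpa using this
  refine ⟨ext' hp hcol, ?_⟩
  have hbl : ∀ i : Fin n, block T i.val = block T' i.val := by
    intro i
    have := congrFun hb (g.perm i)
    simp only [letterBlock, Equiv.symm_apply_apply] at this
    rw [hp] at this
    simpa using this
  ext i
  by_cases hi : i.val + 1 < n
  · have e1 := block_succ T i
    have e2 := block_succ T' i
    have e3 := hbl ⟨i.val + 1, hi⟩
    have e4 := hbl i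
    simp only at e3
    by_cases a1 : i ∈ T <;> by_cases a2 : i ∈ T' <;> simp_all
  · exact iff_of_false (fun h => hi (mem_asc.1 (hT h)).1) (fun h => hi (mem_asc.1 (hT' h)).1)

lemma exists_letterBlock_eq {k : ℕ} {g : ColoredPerm n r} {T : Finset (Fin n)} (hT : T ⊆ g.asc)
    (hcard : T.card = n - k) (hn : 1 ≤ n) (hk : k ≤ n) :
    (∀ j, g.letterBlock T j < k) ∧ ∀ b < k, ∃ j, g.letterBlock T j = b := by
  have h := block_last hT hn
  constructor
  · intro j
    have : block T (g.perm.symm j).val ≤ block T (n - 1) := block_mono T (by omega)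
    unfold letterBlock
    omega
  · intro b hb
    obtain ⟨i, hi⟩ := exists_block_eq T (n - 1) (by omega) b (by omega)
    exact ⟨g.perm i, by simpa [letterBlock] using hi⟩

/-- The set of ascents that encodes a weakly decreasing sequence: the `j`-th chosen ascent has
`e j` ascents that are not chosen after it. -/
lemma exists_ascent_encoding {k : ℕ} (hk : k ≤ n) (g : ColoredPerm n r) (hg : g.des < k) :
    ∃ φ : {e : Fin (n - k) → ℕ // Antitone e ∧ ∀ j, e j < k - g.des} → Finset (Fin n),
      Function.Injective φ ∧ ∀ e, φ e ⊆ g.asc ∧ (φ e).card = n - k := by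
  -- Of the `n - 1 - des` ascents, `k - 1 - des` stay unchosen. With `e j` of these after the `j`-th
  -- chosen ascent, `k - 1 - des - e j` come before it, which gives its index.
  have hs : ∀ (e : {e : Fin (n - k) → ℕ // Antitone e ∧ ∀ j, e j < k - g.des}) (j : Fin (n - k)),
      j.val + (k - 1 - g.des - e.1 j) < n - 1 - g.des := by
    intro e j
    have := j.isLt
    omega
  let s : {e : Fin (n - k) → ℕ // Antitone e ∧ ∀ j, e j < k - g.des} →
      Fin (n - k) → Fin (n - 1 - g.des) :=
    fun e j => ⟨j.val + (k - 1 - g.des - e.1 j), hs e j⟩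
  let F := g.asc.orderEmbOfFin g.card_asc
  have hmono : ∀ e, StrictMono (F ∘ s e) := by
    intro e
    refine F.strictMono.comp ?_
    intro i j hij
    have h1 := e.2.1 hij.le
    have h2 : i.val < j.val := hij
    change i.val + _ < j.val + _
    omega
  refine ⟨fun e => Finset.univ.map ⟨F ∘ s e, (hmono e).injective⟩, ?_, ?_⟩
  · intro e e' h
    have hr : Set.range (F ∘ s e) = Set.range (F ∘ s e') := by
      have := congrArg (fun t : Finset (Fin n) => (t : Set (Fin n))) h
      simpa [Function.comp_def] using this
    have h2 := (StrictMono.range_inj (hmono e) (hmono e')).1 hr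
    apply Subtype.ext
    funext j
    have h3 := congrArg Fin.val (F.injective (congrFun h2 j))
    have a1 := e.2.2 j
    have a2 := e'.2.2 j
    simp only [s] at h3
    omega
  · intro e
    constructor
    · intro i hi
      simp only [Finset.mem_map, Finset.mem_univ, true_and, Function.Embedding.coeFn_mk] at hi
      obtain ⟨j, rfl⟩ := hi
      exact Finset.orderEmbOfFin_mem _ _ _
    · simp

end ColoredPerm

/-- Index set for the points at which polynomials are evaluated: a color for each letter and a
map of the letters onto the set of `k` blocks. -/
abbrev PointIndex (n k r : ℕ) : Type :=
  (Fin n → Fin r) × {f : Fin n → Fin k // Function.Surjective f}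

open ColoredPerm in
-- Only this inequality of cardinalities is needed, so any choice of `(g, e)` representing each
-- monomial will do.
theorem exists_injective_pointIndex {n k r : ℕ} (hn : 1 ≤ n) (hk : k ≤ n) :
    ∃ F : descentMonomials n k r → PointIndex n k r, Function.Injective F := by
  classical
  have hD : ∀ m : descentMonomials n k r, ∃ (g : ColoredPerm n r) (e : Fin (n - k) → ℕ),
    g.des < k ∧ Antitone e ∧ (∀ j, e j < k - g.des) ∧
    (m : MvPolynomial (Fin n) ℂ) = g.descentMonomial *
      ∏ j : Fin (n - k), X (g.perm (Fin.castLE (Nat.sub_le n k) j)) ^ (r * e j) := fun m => m.2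
  choose g e hg he1 he2 hm using hD
  have hφ := fun (g : {g : ColoredPerm n r // g.des < k}) =>
    exists_ascent_encoding hk g.1 g.2
  choose φ hφ1 hφ2 using hφ
  let E := fun m => φ ⟨g m, hg m⟩ ⟨e m, he1 m, he2 m⟩
  have hE : ∀ m, E m ⊆ (g m).asc ∧ (E m).card = n - k := fun m =>
    hφ2 ⟨g m, hg m⟩ ⟨e m, he1 m, he2 m⟩
  have hB := fun m => exists_letterBlock_eq (hE m).1 (hE m).2 hn hk
  refine ⟨fun m => ((g m).letterColor,
    ⟨fun j => ⟨(g m).letterBlock (E m) j, (hB m).1 j⟩, fun b => ?_⟩), ?_⟩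
  · obtain ⟨j, hj⟩ := (hB m).2 b.val b.isLt
    exact ⟨j, Fin.ext hj⟩
  · intro m m' h
    obtain ⟨h0, h⟩ := Prod.mk.inj h
    have h := congrArg Subtype.val h
    have h2 : (g m).letterBlock (E m) = (g m').letterBlock (E m') := by
      funext j
      exact congrArg Fin.val (congrFun h j)
    obtain ⟨h3, h4⟩ := eq_of_letterColor_letterBlock (hE m).1 (hE m').1 h0 h2
    have h5 : e m = e m' := by
      have : ∀ (a b : {g : ColoredPerm n r // g.des < k}) (x y) (hx) (hy), a = b →
          φ a ⟨x, hx⟩ = φ b ⟨y, hy⟩ → x = y := by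
        rintro a b x y hx hy rfl hxy
        exact congrArg Subtype.val (hφ1 a hxy)
      exact this ⟨g m, hg m⟩ ⟨g m', hg m'⟩ _ _ _ _ (Subtype.ext h3) h4
    apply Subtype.ext
    rw [hm m, hm m', h3, h5]

/-! ### Degree filtration and the generators of the ideal -/

/-- The span of the monomials of degree less than `e`. -/
noncomputable def lowDegree (n e : ℕ) : Submodule ℂ (MvPolynomial (Fin n) ℂ) :=
  Submodule.span ℂ {p | ∃ a : Fin n →₀ ℕ, a.degree < e ∧ p = monomial a 1}

lemma monomial_mem_lowDegree {n e : ℕ} {a : Fin n →₀ ℕ} (h : a.degree < e) :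
    (monomial a 1 : MvPolynomial (Fin n) ℂ) ∈ lowDegree n e :=
  Submodule.subset_span ⟨a, h, rfl⟩

lemma monomial_mul_mem_lowDegree {n e : ℕ} (b : Fin n →₀ ℕ) {q : MvPolynomial (Fin n) ℂ}
    (hq : q ∈ lowDegree n e) : monomial b 1 * q ∈ lowDegree n (b.degree + e) := by
  induction hq using Submodule.span_induction with
  | mem x hx =>
    obtain ⟨a, ha, rfl⟩ := hx
    rw [monomial_mul, one_mul]
    exact monomial_mem_lowDegree (by rw [map_add]; omega)
  | zero => rw [mul_zero]; exact Submodule.zero_mem _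
  | add x y _ _ hx hy => rw [mul_add]; exact Submodule.add_mem _ hx hy
  | smul c x _ hx => rw [mul_smul_comm]; exact Submodule.smul_mem _ _ hx

lemma aeval_X_mem_lowDegree {n N : ℕ} (i : Fin n) {q : Polynomial ℂ} (hq : q.degree < N) :
    Polynomial.aeval (X i : MvPolynomial (Fin n) ℂ) q ∈ lowDegree n N := by
  rw [Polynomial.aeval_eq_sum_range]
  refine Submodule.sum_mem _ fun m _ => ?_
  by_cases hm : q.coeff m = 0
  · rw [hm, zero_smul]; exact Submodule.zero_mem _
  · refine Submodule.smul_mem _ _ ?_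
    rw [X_pow_eq_monomial]
    refine monomial_mem_lowDegree ?_
    rw [Finsupp.degree_single]
    have := (Polynomial.le_degree_of_ne_zero hm).trans_lt hq
    exact_mod_cast this

/-- The monomial with exponent `r` on the variables in `t`. -/
noncomputable def setExp {n : ℕ} (r : ℕ) (t : Finset (Fin n)) : Fin n →₀ ℕ :=
  ∑ i ∈ t, Finsupp.single i r

lemma degree_setExp {n r : ℕ} (t : Finset (Fin n)) : (setExp r t).degree = t.card * r := by
  rw [setExp, map_sum]
  simp [Finsupp.degree_single]

lemma setExp_apply {n r : ℕ} (t : Finset (Fin n)) (j : Fin n) :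
    setExp r t j = if j ∈ t then r else 0 := by
  rw [setExp, Finsupp.finsetSum_apply]
  simp [Finsupp.single_apply]

lemma esymmPow_eq_sum (n r d : ℕ) :
    esymmPow n r d = ∑ t ∈ Finset.powersetCard d Finset.univ, monomial (setExp r t) 1 := by
  refine Finset.sum_congr rfl fun t _ => ?_
  rw [setExp, monomial_sum_one]
  simp [X_pow_eq_monomial]

lemma esymmPow_mem_lowDegree {n r d e : ℕ} (h : d * r < e) : esymmPow n r d ∈ lowDegree n e := by
  rw [esymmPow_eq_sum]
  refine Submodule.sum_mem _ fun t ht => monomial_mem_lowDegree ?_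
  rwa [degree_setExp, (Finset.mem_powersetCard.1 ht).2]

/-- The generators of `idealJ n k r`, with their degrees. -/
def IsGenerator (n k r : ℕ) (p : MvPolynomial (Fin n) ℂ) (e : ℕ) : Prop :=
  (∃ i : Fin n, p = X i ^ (k * r) ∧ e = k * r) ∨
    ∃ d : ℕ, n - k + 1 ≤ d ∧ d ≤ n ∧ p = esymmPow n r d ∧ e = d * r

/-! ### The point set, and generators dropping in degree on it -/

section Points

variable {n k r : ℕ}

/-- The point of `ℂⁿ` with coordinates `(f j + 1) ω ^ c j`, where `ω` is a primitive `r`-th root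
of unity. -/
noncomputable def point (p : PointIndex n k r) (j : Fin n) : ℂ :=
  (((p.2.1 j).val + 1 : ℕ) : ℂ) * Complex.exp (2 * Real.pi * Complex.I / r) ^ (p.1 j).val

lemma point_pow (hr : 1 ≤ r) (p : PointIndex n k r) (j : Fin n) :
    point p j ^ r = (((p.2.1 j).val + 1 : ℕ) : ℂ) ^ r := by
  have h := (Complex.isPrimitiveRoot_exp r (by omega)).pow_eq_one
  rw [point, mul_pow, ← pow_mul, mul_comm _ r, pow_mul, h, one_pow, mul_one]

/-- The modulus of a coordinate gives the block; since that modulus is nonzero, the remaining root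
of unity gives the color. -/
lemma point_injective (hr : 1 ≤ r) :
    Function.Injective (point : PointIndex n k r → Fin n → ℂ) := by
  have hω := Complex.isPrimitiveRoot_exp r (by omega)
  rintro ⟨c, f⟩ ⟨c', f'⟩ h
  have h1 : ∀ j, f.1 j = f'.1 j := by
    intro j
    have h2 := congrArg norm (congrFun h j)
    simp only [point, norm_mul, norm_pow, hω.norm'_eq_one (by omega), one_pow, mul_one,
      Complex.norm_natCast, Nat.cast_inj] at h2
    exact Fin.ext (by omega)
  have h3 : ∀ j, c j = c' j := by
    intro j
    have h2 := congrFun h j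
    simp only [point, h1 j] at h2
    have h4 := mul_left_cancel₀ (Nat.cast_ne_zero.2 (Nat.succ_ne_zero _)) h2
    exact Fin.ext (hω.pow_inj (c j).isLt (c' j).isLt h4)
  exact Prod.ext (funext h3) (Subtype.ext (funext h1))

/-- Evaluation at all the points. -/
noncomputable def evalPoints (n k r : ℕ) :
    MvPolynomial (Fin n) ℂ →ₗ[ℂ] (PointIndex n k r → ℂ) :=
  LinearMap.pi fun p => (aeval (point p)).toLinearMap

lemma evalPoints_apply (q : MvPolynomial (Fin n) ℂ) (p : PointIndex n k r) :
    evalPoints n k r q p = aeval (point p) q := rfl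

lemma evalPoints_mul_congr {q q' : MvPolynomial (Fin n) ℂ} (m : MvPolynomial (Fin n) ℂ)
    (h : evalPoints n k r q = evalPoints n k r q') :
    evalPoints n k r (m * q) = evalPoints n k r (m * q') := by
  funext p
  have := congrFun h p
  simp only [evalPoints_apply, map_mul] at this ⊢
  rw [this]

/-- Lagrange interpolation: a product of affine functions, each equal to 1 at `x i` and vanishing at
one other point. -/
lemma exists_aeval_eq_pi_single {σ ι K : Type*} [Field K] [Fintype ι] [DecidableEq ι]
    {x : ι → σ → K} (hx : Function.Injective x) (i : ι) :
    ∃ q : MvPolynomial σ K, ∀ j, aeval (x j) q = (Pi.single i 1 : ι → K) j := by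
  have h : ∀ j : ι, ∃ q : MvPolynomial σ K,
      aeval (x i) q = 1 ∧ (j ≠ i → aeval (x j) q = 0) := by
    intro j
    by_cases hj : j = i
    · exact ⟨1, by simp, fun h => absurd hj h⟩
    · obtain ⟨s, hs⟩ := Function.ne_iff.1 (hx.ne hj)
      refine ⟨C (x i s - x j s)⁻¹ * (X s - C (x j s)), ?_, fun _ => ?_⟩
      · have : x i s - x j s ≠ 0 := sub_ne_zero.2 (Ne.symm hs)
        simp [this]
      · simp
  choose q h1 h2 using h
  refine ⟨∏ j, q j, fun j => ?_⟩
  rw [map_prod]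
  by_cases hj : j = i
  · subst hj
    simp [h1]
  · rw [Pi.single_eq_of_ne hj]
    exact Finset.prod_eq_zero (Finset.mem_univ j) (h2 j hj)

lemma evalPoints_surjective (hr : 1 ≤ r) : Function.Surjective (evalPoints n k r) := by
  classical
  intro v
  have h := fun i => exists_aeval_eq_pi_single (point_injective (n := n) (k := k) hr) i
  choose q hq using h
  refine ⟨∑ i, v i • q i, ?_⟩
  funext p
  rw [evalPoints_apply, map_sum]
  simp [hq, Pi.single_apply]

/-- Every coordinate of every point is a root of the monic polynomial `∏ (X ^ r - (b + 1) ^ r)` of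
degree `k * r`, so subtracting it removes the top power. -/
lemma generator_X_agrees (hr : 1 ≤ r) (i : Fin n) :
    ∃ q ∈ lowDegree n (k * r), evalPoints n k r (X i ^ (k * r)) = evalPoints n k r q := by
  let P : Polynomial ℂ :=
    ∏ b : Fin k, (Polynomial.X ^ r - Polynomial.C (((b.val + 1 : ℕ) : ℂ) ^ r))
  have hP : P.Monic := Polynomial.monic_prod_of_monic _ _ fun b _ =>
    Polynomial.monic_X_pow_sub_C _ (by omega)
  have hdeg : P.degree = (k * r : ℕ) := by
    rw [Polynomial.degree_eq_natDegree hP.ne_zero, Polynomial.natDegree_prod_of_monic _ _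
      fun b _ => Polynomial.monic_X_pow_sub_C _ (by omega)]
    rw [Finset.sum_congr rfl fun b _ => Polynomial.natDegree_X_pow_sub_C]
    simp
  have hlt : (Polynomial.X ^ (k * r) - P).degree < ((k * r : ℕ) : WithBot ℕ) := by
    have := Polynomial.degree_sub_lt_left (p := Polynomial.X ^ (k * r)) (q := P)
      (by rw [hdeg, Polynomial.degree_X_pow]) (pow_ne_zero _ Polynomial.X_ne_zero)
      (by rw [hP.leadingCoeff, (Polynomial.monic_X_pow _).leadingCoeff])
    rwa [Polynomial.degree_X_pow] at this
  refine ⟨_, aeval_X_mem_lowDegree i hlt, ?_⟩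
  funext p
  have : aeval (point p) (Polynomial.aeval (X i : MvPolynomial (Fin n) ℂ) P) = 0 := by
    simp only [P, map_prod]
    refine Finset.prod_eq_zero (Finset.mem_univ (p.2.1 i)) ?_
    simp [point_pow hr]
  simp only [evalPoints_apply, map_sub, this, map_pow, Polynomial.aeval_X, sub_zero]

lemma coeff_prod_one_add_C_mul_X {ι : Type*} [Fintype ι] (y : ι → ℂ) (d : ℕ) :
    PowerSeries.coeff d (∏ i, (1 + PowerSeries.C (y i) * PowerSeries.X))
      = ∑ t ∈ Finset.powersetCard d Finset.univ, ∏ i ∈ t, y i := by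
  classical
  rw [Finset.prod_one_add, map_sum, Finset.powersetCard_eq_filter, Finset.sum_filter]
  refine Finset.sum_congr rfl fun t _ => ?_
  rw [Finset.prod_mul_distrib, Finset.prod_const, ← map_prod, PowerSeries.coeff_C_mul_X_pow]
  simp only [eq_comm]

lemma aeval_esymmPow (x : Fin n → ℂ) (d : ℕ) :
    aeval x (esymmPow n r d)
      = PowerSeries.coeff d (∏ i, (1 + PowerSeries.C (x i ^ r) * PowerSeries.X)) := by
  rw [coeff_prod_one_add_C_mul_X, esymmPow, map_sum]
  simp

lemma coeff_prod_eq_zero {ι : Type*} [DecidableEq ι] (s : Finset ι) (y : ι → ℂ) (d : ℕ)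
    (h : s.card < d) :
    PowerSeries.coeff d (∏ i ∈ s, (1 + PowerSeries.C (y i) * PowerSeries.X)) = 0 := by
  have : (∏ i ∈ s, (1 + PowerSeries.C (y i) * PowerSeries.X))
      = ((∏ i ∈ s, (1 + Polynomial.C (y i) * Polynomial.X) : Polynomial ℂ) : PowerSeries ℂ) := by
    rw [← Polynomial.coeToPowerSeries.ringHom_apply, map_prod]
    simp
  rw [this, Polynomial.coeff_coe]
  refine Polynomial.coeff_eq_zero_of_natDegree_lt (lt_of_le_of_lt ?_ h)
  refine (Polynomial.natDegree_prod_le _ _).trans ?_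
  rw [Finset.card_eq_sum_ones]
  refine Finset.sum_le_sum fun i _ => ?_
  compute_degree

/-- At a point, `∏ (1 + x_i^r t)` is divisible by the fixed polynomial `Q(t)`, because every block
occurs. The quotient has degree at most `n - k < d`, so its coefficient at `t^d` vanishes; expanding
that coefficient with `Q⁻¹` expresses `e_d` through the `e_a` with `a < d`. -/
lemma generator_esymmPow_agrees (hr : 1 ≤ r) (d : ℕ) (hd : n - k + 1 ≤ d) :
    ∃ q ∈ lowDegree n (d * r), evalPoints n k r (esymmPow n r d) = evalPoints n k r q := by
  classical
  let Q : PowerSeries ℂ :=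
    ∏ b : Fin k, (1 + PowerSeries.C (((b.val + 1 : ℕ) : ℂ) ^ r) * PowerSeries.X)
  have hQ : PowerSeries.constantCoeff Q = 1 := by simp [Q, map_prod]
  have hQ' : Q * Q⁻¹ = 1 := PowerSeries.mul_inv_cancel _ (by rw [hQ]; exact one_ne_zero)
  have hc : PowerSeries.coeff 0 Q⁻¹ = 1 := by
    rw [PowerSeries.coeff_zero_eq_constantCoeff_apply, PowerSeries.constantCoeff_inv, hQ, inv_one]
  refine ⟨-∑ a ∈ Finset.range d, PowerSeries.coeff (d - a) Q⁻¹ • esymmPow n r a, ?_, ?_⟩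
  · refine Submodule.neg_mem _ (Submodule.sum_mem _ fun a ha => Submodule.smul_mem _ _ ?_)
    exact esymmPow_mem_lowDegree (Nat.mul_lt_mul_of_pos_right (Finset.mem_range.1 ha) (by omega))
  · funext p
    -- A section of the surjection picks one letter per block; the factors of these `k` letters
    -- multiply to `Q`.
    obtain ⟨s, hs⟩ := p.2.2.hasRightInverse
    have hfac : (∏ i, (1 + PowerSeries.C (point p i ^ r) * PowerSeries.X)) * Q⁻¹
        = ∏ i ∈ (Finset.univ.map ⟨s, hs.injective⟩)ᶜ,
          (1 + PowerSeries.C (point p i ^ r) * PowerSeries.X) := by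
      have h1 : Q = ∏ i ∈ Finset.univ.map ⟨s, hs.injective⟩,
          (1 + PowerSeries.C (point p i ^ r) * PowerSeries.X) := by
        rw [Finset.prod_map]
        refine Finset.prod_congr rfl fun b _ => ?_
        rw [point_pow hr]
        simp only [Function.Embedding.coeFn_mk]
        rw [hs b]
      rw [← Finset.prod_compl_mul_prod (Finset.univ.map ⟨s, hs.injective⟩), ← h1, mul_assoc, hQ',
        mul_one]
    have hcoef := congrArg (PowerSeries.coeff d) hfac
    rw [coeff_prod_eq_zero _ _ _ (by
      rw [Finset.card_compl, Finset.card_map, Finset.card_univ, Fintype.card_fin,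
        Fintype.card_fin]; omega), PowerSeries.coeff_mul,
      Finset.Nat.sum_antidiagonal_eq_sum_range_succ_mk, Finset.sum_range_succ] at hcoef
    simp only [Nat.sub_self, hc, mul_one] at hcoef
    rw [evalPoints_apply, evalPoints_apply, aeval_esymmPow, map_neg, map_sum]
    simp only [map_smul, aeval_esymmPow, smul_eq_mul]
    rw [eq_neg_iff_add_eq_zero, add_comm, ← hcoef]
    congr 1
    exact Finset.sum_congr rfl fun a _ => mul_comm _ _

lemma generator_agrees (hr : 1 ≤ r) {p : MvPolynomial (Fin n) ℂ} {e : ℕ}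
    (h : IsGenerator n k r p e) :
    ∃ q ∈ lowDegree n e, evalPoints n k r p = evalPoints n k r q := by
  rcases h with ⟨i, rfl, rfl⟩ | ⟨d, hd, -, rfl, rfl⟩
  · exact generator_X_agrees hr i
  · exact generator_esymmPow_agrees hr d hd

end Points

/-! ### Straightening: weights and the potential -/

/-- The span of the multiples, homogeneous of degree `e`, of the generators of `idealJ n k r`. -/
noncomputable def idealDegree (n k r e : ℕ) : Submodule ℂ (MvPolynomial (Fin n) ℂ) :=
  Submodule.span ℂ {p | ∃ (b : Fin n →₀ ℕ) (g : MvPolynomial (Fin n) ℂ) (d : ℕ),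
    IsGenerator n k r g d ∧ b.degree + d = e ∧ p = monomial b 1 * g}

/-- The span of the descent monomials of degree `e`. -/
noncomputable def descentDegree (n k r e : ℕ) : Submodule ℂ (MvPolynomial (Fin n) ℂ) :=
  Submodule.span ℂ {p | p ∈ descentMonomials n k r ∧
    ∃ a : Fin n →₀ ℕ, a.degree = e ∧ p = monomial a 1}

/-- The weight of a variable in a monomial; distinct variables have distinct weights. -/
def weight {n : ℕ} (a : Fin n → ℕ) (j : Fin n) : ℕ := n * a j + j.rev.val

/-- The reversed index is less than `n`, so weights compare exponents first and break ties in favor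
of the smaller index. -/
lemma weight_lt_iff {n : ℕ} {a : Fin n → ℕ} {i j : Fin n} :
    weight a j < weight a i ↔ a j < a i ∨ a j = a i ∧ i < j := by
  have hi := i.rev.isLt
  have hj := j.rev.isLt
  have hr : j.rev.val < i.rev.val ↔ i < j := by
    rw [← Fin.lt_def, Fin.rev_lt_rev]
  rw [← hr]
  unfold weight
  rcases lt_trichotomy (a j) (a i) with h | h | h
  · have : n * (a j + 1) ≤ n * a i := Nat.mul_le_mul_left n h
    rw [mul_add] at this
    exact iff_of_true (by omega) (Or.inl h)
  · rw [h]; simp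
  · have : n * (a i + 1) ≤ n * a j := Nat.mul_le_mul_left n h
    rw [mul_add] at this
    exact iff_of_false (by omega) (by omega)

lemma weight_injective {n : ℕ} (a : Fin n → ℕ) : Function.Injective (weight a) := by
  intro i j h
  have h1 := (weight_lt_iff (a := a) (i := i) (j := j)).not.1 h.symm.not_lt
  have h2 := (weight_lt_iff (a := a) (i := j) (j := i)).not.1 h.not_lt
  push Not at h1 h2
  have : a i = a j := le_antisymm h1.1 h2.1
  exact le_antisymm (h2.2 this) (h1.2 this.symm)

/-- The statistic that decreases under straightening. -/
def potential {n : ℕ} (a : Fin n → ℕ) : ℕ := ∑ j, weight a j ^ 2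

lemma sum_lt_sum_of_separated {n : ℕ} {w : Fin n → ℕ} {S T : Finset (Fin n)}
    (hcard : S.card = T.card) (hne : S ≠ T) (h : ∀ i ∈ T, ∀ j ∉ T, w j < w i) :
    ∑ j ∈ S, w j < ∑ j ∈ T, w j := by
  have hc : (S \ T).card = (T \ S).card := by
    have h1 := Finset.card_sdiff_add_card_inter S T
    have h2 := Finset.card_sdiff_add_card_inter T S
    rw [Finset.inter_comm] at h2
    omega
  have hS : ∑ j ∈ S, w j = ∑ j ∈ S \ T, w j + ∑ j ∈ S ∩ T, w j :=
    by
    rw [add_comm]; exact (Finset.sum_inter_add_sum_sdiff S T w).symm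
  have hT : ∑ j ∈ T, w j = ∑ j ∈ T \ S, w j + ∑ j ∈ S ∩ T, w j := by
    
    rw [Finset.inter_comm, add_comm]; exact (Finset.sum_inter_add_sum_sdiff T S w).symm
  rw [hS, hT]
  refine Nat.add_lt_add_right ?_ _
  have hTS : (T \ S).Nonempty := by
    rw [Finset.nonempty_iff_ne_empty]
    intro h0
    rw [h0, Finset.card_empty, Finset.card_eq_zero] at hc
    exact hne (Finset.Subset.antisymm (Finset.sdiff_eq_empty_iff_subset.1 hc)
      (Finset.sdiff_eq_empty_iff_subset.1 h0))
  obtain ⟨i, hi, hmin⟩ := Finset.exists_min_image (T \ S) w hTS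
  have hi' := (Finset.mem_sdiff.1 hi).1
  calc ∑ j ∈ S \ T, w j < ∑ j ∈ S \ T, w i := by
        refine Finset.sum_lt_sum_of_nonempty ?_ fun j hj => h i hi' j (Finset.mem_sdiff.1 hj).2
        rw [← Finset.card_pos, hc, Finset.card_pos]; exact hTS
    _ = ∑ j ∈ T \ S, w i := by rw [Finset.sum_const, Finset.sum_const, hc]
    _ ≤ ∑ j ∈ T \ S, w j := Finset.sum_le_sum hmin

lemma potential_add_setExp {n r : ℕ} (a : Fin n →₀ ℕ) (S : Finset (Fin n)) :
    potential (a + setExp r S : Fin n →₀ ℕ)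
      = potential a + S.card * (n * r) ^ 2 + 2 * (n * r) * ∑ j ∈ S, weight a j := by
  have : ∀ j, weight (a + setExp r S : Fin n →₀ ℕ) j ^ 2
      = weight a j ^ 2 + if j ∈ S then (n * r) ^ 2 + 2 * (n * r) * weight a j else 0 := by
    intro j
    simp only [weight, Finsupp.add_apply, setExp_apply]
    split_ifs <;> ring
  unfold potential
  rw [Finset.sum_congr rfl fun j _ => this j, Finset.sum_add_distrib, Finset.sum_ite_mem,
    Finset.univ_inter, Finset.sum_add_distrib, Finset.sum_const, ← Finset.mul_sum, smul_eq_mul,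
    add_assoc]

/-- Raising the weights on `S` by `n * r` changes the sum of squares by a term depending on `S.card`
plus a positive multiple of the weight of `S`; among sets of equal size, the heaviest letters win
strictly. -/
lemma potential_lt {n r : ℕ} (hn : 1 ≤ n) (hr : 1 ≤ r) {a : Fin n →₀ ℕ} {S T : Finset (Fin n)}
    (hcard : S.card = T.card) (hne : S ≠ T) (h : ∀ i ∈ T, ∀ j ∉ T, weight a j < weight a i) :
    potential (a + setExp r S : Fin n →₀ ℕ) < potential (a + setExp r T : Fin n →₀ ℕ) := by
  rw [potential_add_setExp, potential_add_setExp, hcard]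
  refine Nat.add_lt_add_left ?_ _
  exact Nat.mul_lt_mul_of_pos_left (sum_lt_sum_of_separated hcard hne h) (by positivity)

namespace ColoredPerm

variable {n k r : ℕ}

lemma dseq_succ (g : ColoredPerm n r) (i : Fin n) (h : i.val + 1 < n) :
    g.dseq i = g.dseq ⟨i.val + 1, h⟩ + if i ∈ g.Des then 1 else 0 := by
  unfold dseq
  have h1 : ∀ j : Fin n, (⟨i.val + 1, h⟩ : Fin n) ≤ j ↔ i < j := by
    intro j; rw [Fin.le_def, Fin.lt_def]; simp only; omega
  simp only [h1]
  split_ifs with hi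
  · rw [← Finset.card_insert_of_notMem (a := i) (by simp)]
    congr 1
    ext j
    simp only [Finset.mem_filter, Finset.mem_insert]
    constructor
    · rintro ⟨a1, a2⟩
      rcases a2.eq_or_lt with rfl | a3
      · exact Or.inl rfl
      · exact Or.inr ⟨a1, a3⟩
    · rintro (rfl | ⟨a1, a2⟩)
      · exact ⟨hi, le_rfl⟩
      · exact ⟨a1, a2.le⟩
  · rw [add_zero]
    congr 1
    ext j
    simp only [Finset.mem_filter]
    constructor
    · rintro ⟨a1, a2⟩
      rcases a2.eq_or_lt with rfl | a3
      · exact absurd a1 hi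
      · exact ⟨a1, a3⟩
    · rintro ⟨a1, a2⟩
      exact ⟨a1, a2.le⟩

lemma dseq_last (g : ColoredPerm n r) (i : Fin n) (h : ¬ i.val + 1 < n) : g.dseq i = 0 := by
  unfold dseq
  rw [Finset.card_eq_zero, Finset.filter_eq_empty_iff]
  intro j hj hij
  obtain ⟨h', -⟩ := mem_Des.1 hj
  rw [Fin.le_def] at hij
  omega

lemma dseq_zero (g : ColoredPerm n r) (h : 0 < n) : g.dseq ⟨0, h⟩ = g.des := by
  unfold dseq des
  congr 1
  rw [Finset.filter_eq_self]
  intro j _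
  exact Fin.mk_le_of_le_val (Nat.zero_le _)

/-- Here `μ` is the sequence `i_1 ≥ ⋯ ≥ i_{n-k}` extended by zeros to all positions. -/
lemma monomial_mem_descentMonomials (hn : 1 ≤ n) (g : ColoredPerm n r) (a : Fin n →₀ ℕ)
    {μ : Fin n → ℕ} (ha : ∀ i, a (g.perm i) = r * g.dseq i + (g.color i).val + r * μ i)
    (hμ : Antitone μ) (h0 : ∀ i : Fin n, n - k ≤ i.val → μ i = 0)
    (hlt : ∀ i, g.dseq i + μ i < k) :
    (monomial a 1 : MvPolynomial (Fin n) ℂ) ∈ descentMonomials n k r := by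
  have hd := hlt ⟨0, hn⟩
  rw [dseq_zero] at hd
  refine ⟨g, fun j => μ (Fin.castLE (Nat.sub_le n k) j), by omega, ?_, ?_, ?_⟩
  · intro i j hij
    exact hμ (by simpa using hij)
  · intro j
    have := hμ (show (⟨0, hn⟩ : Fin n) ≤ Fin.castLE (Nat.sub_le n k) j from
      Fin.mk_le_of_le_val (Nat.zero_le _))
    simp only
    omega
  · have h1 : ∏ j : Fin (n - k), (X (g.perm (Fin.castLE (Nat.sub_le n k) j)) :
        MvPolynomial (Fin n) ℂ) ^ (r * μ (Fin.castLE (Nat.sub_le n k) j))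
        = ∏ i, X (g.perm i) ^ (r * μ i) := by
      refine Fintype.prod_of_injective (Fin.castLE (Nat.sub_le n k)) (Fin.castLE_injective _) _ _
        (fun i hi => ?_) fun _ => rfl
      rw [h0 i, mul_zero, pow_zero]
      by_contra hlt
      exact hi ⟨⟨i.val, by omega⟩, rfl⟩
    rw [h1, descentMonomial, ← Finset.prod_mul_distrib]
    simp only [← pow_add, ← ha]
    rw [Equiv.prod_comp g.perm fun j => (X j : MvPolynomial (Fin n) ℂ) ^ a j, monomial_eq, C_1,
      one_mul, Finsupp.prod_fintype _ _ fun _ => pow_zero _]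

end ColoredPerm

/-! ### Sorting the exponents of a monomial -/

section Sorting

variable {n k r : ℕ}

lemma exists_sorting_perm (a : Fin n → ℕ) :
    ∃ π : Equiv.Perm (Fin n), StrictAnti (weight a ∘ π) := by
  refine ⟨Tuple.sort (OrderDual.toDual ∘ weight a), ?_⟩
  have h := (Tuple.monotone_sort (OrderDual.toDual ∘ weight a)).strictMono_of_injective
    ((OrderDual.toDual.injective.comp (weight_injective a)).comp (Equiv.injective _))
  intro i j hij
  exact OrderDual.toDual_lt_toDual.1 (h hij)

/-- The colored permutation that sorts the exponents of a monomial, with the residues modulo `r`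
of the exponents as colors. -/
def sortedColoredPerm (hr : 1 ≤ r) (a : Fin n → ℕ) (π : Equiv.Perm (Fin n)) : ColoredPerm n r :=
  ⟨π, fun i => ⟨a (π i) % r, Nat.mod_lt _ hr⟩⟩

/-- With equal quotients, sorted exponents give weakly decreasing remainders, and equal exponents
appear in increasing letter order. That is an ascent, so a descent forces the quotient to drop. -/
lemma sorted_div_le (hr : 1 ≤ r) (a : Fin n → ℕ) {π : Equiv.Perm (Fin n)}
    (hπ : StrictAnti (weight a ∘ π)) (i : Fin n) (h : i.val + 1 < n) :
    a (π ⟨i.val + 1, h⟩) / r + (if i ∈ (sortedColoredPerm hr a π).Des then 1 else 0)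
      ≤ a (π i) / r := by
  have h1 : weight a (π ⟨i.val + 1, h⟩) < weight a (π i) := hπ (Fin.lt_def.2 (Nat.lt_succ_self _))
  rw [weight_lt_iff] at h1
  have h2 : a (π ⟨i.val + 1, h⟩) ≤ a (π i) := by omega
  have h3 := Nat.div_le_div_right (c := r) h2
  split_ifs with hi
  · obtain ⟨_, hi⟩ := ColoredPerm.mem_Des.1 hi
    by_contra hcon
    have h4 : a (π ⟨i.val + 1, h⟩) / r = a (π i) / r := by omega
    have e1 := Nat.div_add_mod (a (π i)) r
    have e2 := Nat.div_add_mod (a (π ⟨i.val + 1, h⟩)) r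
    rw [h4] at e2
    simp only [LetterLT, ColoredPerm.letter, sortedColoredPerm, Fin.mk_lt_mk, Fin.mk.injEq] at hi
    rcases hi with hi | ⟨hi, hi'⟩
    · omega
    · have : ¬ π i < π ⟨i.val + 1, h⟩ := not_lt.2 hi'.le
      have : a (π ⟨i.val + 1, h⟩) < a (π i) := by tauto
      omega
  · omega

lemma antitone_sorted_excess (hr : 1 ≤ r) (a : Fin n → ℕ) {π : Equiv.Perm (Fin n)}
    (hπ : StrictAnti (weight a ∘ π)) :
    Antitone fun i => ((a (π i) / r : ℕ) : ℤ) - (sortedColoredPerm hr a π).dseq i := by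
  cases n with
  | zero => intro i; exact i.elim0
  | succ n =>
    rw [Fin.antitone_iff_succ_le]
    intro i
    have h1 := sorted_div_le hr a hπ i.castSucc (by simp)
    have h2 := (sortedColoredPerm hr a π).dseq_succ i.castSucc (by simp)
    have h3 : (⟨i.castSucc.val + 1, by simp⟩ : Fin (n + 1)) = i.succ := rfl
    rw [h3] at h1 h2
    split_ifs at h1 h2 <;> omega

/-- The excess decreases weakly along positions and is nonnegative at the last one, where `dseq` is
0. -/
lemma dseq_le_sorted_div (hr : 1 ≤ r) (a : Fin n → ℕ) {π : Equiv.Perm (Fin n)}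
    (hπ : StrictAnti (weight a ∘ π)) (i : Fin n) :
    (sortedColoredPerm hr a π).dseq i ≤ a (π i) / r := by
  have hn : 0 < n := i.pos
  have h := antitone_sorted_excess hr a hπ
    (show i ≤ ⟨n - 1, by omega⟩ from Fin.le_def.2 (by simp only; omega))
  have h2 := (sortedColoredPerm hr a π).dseq_last ⟨n - 1, by omega⟩ (by simp only; omega)
  have h3 := Int.natCast_nonneg (a (π ⟨n - 1, by omega⟩) / r)
  simp only at h
  rw [h2, Nat.cast_zero, sub_zero] at h
  exact_mod_cast sub_nonneg.1 (h3.trans h)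

/-- Where the excess falls from positive to zero, the left letter stays heavier even after its
exponent loses `r`. This keeps the leading set separated after division. -/
lemma weight_sub_lt (hr : 1 ≤ r) (a : Fin n → ℕ) {π : Equiv.Perm (Fin n)}
    (p : Fin n) (h : p.val + 1 < n)
    (h1 : (sortedColoredPerm hr a π).dseq p < a (π p) / r)
    (h2 : a (π ⟨p.val + 1, h⟩) / r = (sortedColoredPerm hr a π).dseq ⟨p.val + 1, h⟩) :
    weight a (π ⟨p.val + 1, h⟩) + n * r < weight a (π p) := by
  set g := sortedColoredPerm hr a π with hg
  have h3 := g.dseq_succ p h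
  have e1 := Nat.div_add_mod (a (π p)) r
  have e2 := Nat.div_add_mod (a (π ⟨p.val + 1, h⟩)) r
  have m1 := Nat.mod_lt (a (π p)) hr
  have m2 := Nat.mod_lt (a (π ⟨p.val + 1, h⟩)) hr
  have v1 := (π p).rev.isLt
  have v2 := (π ⟨p.val + 1, h⟩).rev.isLt
  have key : a (π ⟨p.val + 1, h⟩) + r < a (π p) ∨
      a (π ⟨p.val + 1, h⟩) + r = a (π p) ∧ π p < π ⟨p.val + 1, h⟩ := by
    by_cases hp : p ∈ g.Des
    · rw [if_pos hp] at h3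
      have : r * (a (π ⟨p.val + 1, h⟩) / r + 2) ≤ r * (a (π p) / r) :=
        Nat.mul_le_mul_left r (by omega)
      rw [mul_add] at this
      left; omega
    · rw [if_neg hp] at h3
      have : r * (a (π ⟨p.val + 1, h⟩) / r + 1) ≤ r * (a (π p) / r) :=
        Nat.mul_le_mul_left r (by omega)
      rw [mul_add] at this
      have hl := ColoredPerm.letterLT_of_notMem_Des h hp
      simp only [hg, LetterLT, ColoredPerm.letter, sortedColoredPerm, Fin.mk_lt_mk,
        Fin.mk.injEq] at hl
      rcases hl with hl | ⟨hl, hl'⟩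
      · left; omega
      · rcases Nat.lt_or_ge (a (π ⟨p.val + 1, h⟩) + r) (a (π p)) with h5 | h5
        · exact Or.inl h5
        · exact Or.inr ⟨by omega, hl'⟩
  unfold weight
  rcases key with key | ⟨key, key'⟩
  · have : n * (a (π ⟨p.val + 1, h⟩) + r + 1) ≤ n * a (π p) := Nat.mul_le_mul_left n key
    rw [mul_add, mul_add] at this
    omega
  · rw [← key, mul_add]
    have : (π ⟨p.val + 1, h⟩).rev.val < (π p).rev.val := by
      rw [← Fin.lt_def, Fin.rev_lt_rev]; exact key'
    omega

end Sorting

/-- A monomial with small exponents that is not a descent monomial is divisible by the leading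
term of some `e_d(x^r)` with `n - k + 1 ≤ d`. -/
lemma exists_leading_set {n k r : ℕ} (hn : 1 ≤ n) (hr : 1 ≤ r) (a : Fin n →₀ ℕ)
    (hlt : ∀ i, a i < k * r)
    (ha : (monomial a 1 : MvPolynomial (Fin n) ℂ) ∉ descentMonomials n k r) :
    ∃ (T : Finset (Fin n)) (b : Fin n →₀ ℕ), n - k + 1 ≤ T.card ∧ a = b + setExp r T ∧
      ∀ i ∈ T, ∀ j ∉ T, weight b j < weight b i := by
  obtain ⟨π, hπ⟩ := exists_sorting_perm a
  set g := sortedColoredPerm hr a π with hg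
  have hle := dseq_le_sorted_div hr a hπ
  have hanti := antitone_sorted_excess hr a hπ
  rw [← hg] at hle hanti
  have hμ : Antitone fun i => a (π i) / r - g.dseq i := by
    intro i j hij
    have := hanti hij
    have := hle i
    have := hle j
    simp only at *
    omega
  -- If the excess vanished from position `n - k` on, it would serve as `μ` and the monomial would
  -- be a descent monomial.
  have hex : ∃ i : Fin n, n - k ≤ i.val ∧ g.dseq i < a (π i) / r := by
    by_contra hcon
    push Not at hcon
    refine ha (g.monomial_mem_descentMonomials hn a (μ := fun i => a (π i) / r - g.dseq i)
      ?_ hμ ?_ ?_)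
    · intro i
      have e1 := Nat.div_add_mod (a (π i)) r
      have e2 : r * g.dseq i + r * (a (π i) / r - g.dseq i) = r * (a (π i) / r) := by
        rw [← mul_add, Nat.add_sub_cancel' (hle i)]
      change a (π i) = r * g.dseq i + a (π i) % r + r * (a (π i) / r - g.dseq i)
      omega
    · intro i hi
      have := hcon i hi
      omega
    · intro i
      have := (Nat.div_lt_iff_lt_mul hr).2 (hlt (π i))
      have := hle i
      omega
  obtain ⟨i, hi, hi'⟩ := hex
  -- `p` is the last position with positive excess. The leading set is the first `p + 1` letters, of
  -- size at least `n - k + 1` as positions start at 0.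
  obtain ⟨p, hp, hmax⟩ := Finset.exists_max_image
    (Finset.univ.filter fun i => g.dseq i < a (π i) / r) id ⟨i, by simpa using hi'⟩
  simp only [Finset.mem_filter, Finset.mem_univ, true_and, id] at hp hmax
  have hip : i.val ≤ p.val := hmax i hi'
  have hmem : ∀ i, π i ∈ (Finset.Iic p).map π.toEmbedding ↔ i ≤ p := by
    intro i
    rw [Finset.mem_map_equiv]; simp
  have hge : ∀ j ∈ (Finset.Iic p).map π.toEmbedding, r ≤ a j := by
    intro j hj
    obtain ⟨i, rfl⟩ := π.surjective j
    have h1 := hμ ((hmem i).1 hj)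
    simp only at h1
    have h2 : 1 ≤ a (π i) / r := by omega
    exact (Nat.one_le_div_iff (by omega)).1 h2
  have hle' : setExp r ((Finset.Iic p).map π.toEmbedding) ≤ a := by
    intro j
    rw [setExp_apply]
    split_ifs with h
    · exact hge j h
    · exact Nat.zero_le _
  have hw : ∀ j, weight a j = weight (a - setExp r ((Finset.Iic p).map π.toEmbedding) :
      Fin n →₀ ℕ) j + if j ∈ (Finset.Iic p).map π.toEmbedding then n * r else 0 := by
    intro j
    unfold weight
    rw [Finsupp.tsub_apply, setExp_apply]
    split_ifs with h
    · have := hge j h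
      obtain ⟨c, hc⟩ := Nat.exists_eq_add_of_le this
      rw [hc, Nat.add_sub_cancel_left]
      ring
    · simp
  refine ⟨(Finset.Iic p).map π.toEmbedding, a - setExp r ((Finset.Iic p).map π.toEmbedding),
    ?_, (tsub_add_cancel_of_le hle').symm, ?_⟩
  · rw [Finset.card_map, Fin.card_Iic]; omega
  · intro u hu v hv
    have w1 := hw u
    have w2 := hw v
    rw [if_pos hu] at w1
    rw [if_neg hv] at w2
    obtain ⟨i, rfl⟩ := π.surjective u
    obtain ⟨j, rfl⟩ := π.surjective v
    rw [hmem] at hu hv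
    have hpj : p.val < j.val := not_le.1 hv
    have hp1 : p.val + 1 < n := by omega
    -- By sortedness the tightest comparison is between positions `p` and `p + 1`.
    have l1 : weight a (π p) ≤ weight a (π i) := hπ.antitone hu
    have l2 : weight a (π j) ≤ weight a (π ⟨p.val + 1, hp1⟩) :=
      hπ.antitone (Fin.le_def.2 hpj)
    have l3 := weight_sub_lt hr a p hp1 hp (by
      refine le_antisymm ?_ (hle _)
      by_contra hcon
      have := hmax ⟨p.val + 1, hp1⟩ (not_le.1 hcon)
      rw [Fin.le_def] at this
      simp only at this
      omega)
    omega

theorem monomial_mem_descentDegree_sup {n k r : ℕ} (hn : 1 ≤ n) (hr : 1 ≤ r)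
    (a : Fin n →₀ ℕ) :
    (monomial a 1 : MvPolynomial (Fin n) ℂ)
      ∈ descentDegree n k r a.degree ⊔ idealDegree n k r a.degree := by
  classical
  induction h : potential a using Nat.strong_induction_on generalizing a with
  | _ N ih =>
  subst h
  by_cases hD : (monomial a 1 : MvPolynomial (Fin n) ℂ) ∈ descentMonomials n k r
  · exact Submodule.mem_sup_left (Submodule.subset_span ⟨hD, a, rfl, rfl⟩)
  by_cases hlt : ∀ i, a i < k * r
  · obtain ⟨T, b, hT, rfl, hw⟩ := exists_leading_set hn hr a hlt hD
    have hsum : (monomial (b + setExp r T) 1 : MvPolynomial (Fin n) ℂ)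
        = monomial b 1 * esymmPow n r T.card
          - ∑ S ∈ (Finset.powersetCard T.card Finset.univ).erase T,
              monomial (b + setExp r S) 1 := by
      rw [esymmPow_eq_sum, Finset.mul_sum, ← Finset.add_sum_erase _ _
        (Finset.mem_powersetCard.2 ⟨Finset.subset_univ T, rfl⟩)]
      simp [monomial_mul]
    rw [hsum]
    refine Submodule.sub_mem _ (Submodule.mem_sup_right (Submodule.subset_span
      ⟨b, _, T.card * r, Or.inr ⟨T.card, hT, ?_, rfl, rfl⟩, ?_, rfl⟩))
      (Submodule.sum_mem _ fun S hS => ?_)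
    · simpa using Finset.card_le_univ T
    · rw [map_add, degree_setExp]
    · obtain ⟨hS1, hS2⟩ := Finset.mem_erase.1 hS
      have hS3 := (Finset.mem_powersetCard.1 hS2).2
      have := ih _ (potential_lt hn hr hS3 hS1 hw) _ rfl
      rwa [show (b + setExp r S).degree = (b + setExp r T).degree by
        rw [map_add, map_add, degree_setExp, degree_setExp, hS3]] at this
  · push Not at hlt
    obtain ⟨i, hi⟩ := hlt
    have hle : Finsupp.single i (k * r) ≤ a := Finsupp.single_le_iff.2 hi
    refine Submodule.mem_sup_right (Submodule.subset_span
      ⟨a - Finsupp.single i (k * r), X i ^ (k * r), k * r, Or.inl ⟨i, rfl, rfl⟩, ?_, ?_⟩)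
    · conv_rhs => rw [← tsub_add_cancel_of_le hle, map_add, Finsupp.degree_single]
    · rw [X_pow_eq_monomial, monomial_mul, tsub_add_cancel_of_le hle, one_mul]

/-! ### Comparing the quotient with functions on the points -/

section Basis

variable {n k r : ℕ}

lemma exists_eq_monomial {m : MvPolynomial (Fin n) ℂ} (hm : m ∈ descentMonomials n k r) :
    ∃ a : Fin n →₀ ℕ, m = monomial a 1 := by
  obtain ⟨g, e, -, -, -, rfl⟩ := hm
  refine ⟨(∑ i, Finsupp.single (g.perm i) (r * g.dseq i + (g.color i).val))
    + ∑ j : Fin (n - k), Finsupp.single (g.perm (Fin.castLE (Nat.sub_le n k) j)) (r * e j), ?_⟩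
  rw [← one_mul (1 : ℂ), ← monomial_mul, monomial_sum_one, monomial_sum_one]
  simp [ColoredPerm.descentMonomial, X_pow_eq_monomial]

lemma IsGenerator.isHomogeneous {p : MvPolynomial (Fin n) ℂ} {e : ℕ}
    (h : IsGenerator n k r p e) : p.IsHomogeneous e := by
  rcases h with ⟨i, rfl, rfl⟩ | ⟨d, -, -, rfl, rfl⟩
  · exact isHomogeneous_X_pow _ _
  · rw [esymmPow_eq_sum]
    refine IsHomogeneous.sum _ _ _ fun t ht => isHomogeneous_monomial _ ?_
    rw [degree_setExp, (Finset.mem_powersetCard.1 ht).2]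

lemma IsGenerator.mem_idealJ {p : MvPolynomial (Fin n) ℂ} {e : ℕ}
    (h : IsGenerator n k r p e) : p ∈ idealJ n k r := by
  refine Ideal.subset_span ?_
  rcases h with ⟨i, rfl, -⟩ | ⟨d, h1, h2, rfl, -⟩
  · exact Or.inl ⟨i, rfl⟩
  · exact Or.inr ⟨d, h1, h2, rfl⟩

lemma mem_idealJ_of_mem_idealDegree {e : ℕ} {p : MvPolynomial (Fin n) ℂ}
    (hp : p ∈ idealDegree n k r e) : p ∈ idealJ n k r := by
  have h : idealDegree n k r e ≤ (idealJ n k r).restrictScalars ℂ := by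
    refine Submodule.span_le.2 ?_
    rintro _ ⟨b, g, d, hg, -, rfl⟩
    exact Ideal.mul_mem_left _ _ hg.mem_idealJ
  exact h hp

lemma homogeneousComponent_mul_generator {g : MvPolynomial (Fin n) ℂ} {d : ℕ}
    (hg : IsGenerator n k r g d) (q : MvPolynomial (Fin n) ℂ) (e : ℕ) :
    homogeneousComponent e (q * g) ∈ idealDegree n k r e := by
  induction q using MvPolynomial.induction_on' with
  | monomial b c =>
    have h1 : monomial b c * g = c • (monomial b 1 * g) := by
      rw [← smul_mul_assoc, smul_monomial, smul_eq_mul, mul_one]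
    have h2 : (monomial b 1 * g).IsHomogeneous (b.degree + d) :=
      (isHomogeneous_monomial 1 rfl).mul hg.isHomogeneous
    rw [h1, map_smul, homogeneousComponent_of_mem ((mem_homogeneousSubmodule _ _).2 h2)]
    refine Submodule.smul_mem _ _ ?_
    split_ifs with h
    · exact Submodule.subset_span ⟨b, g, d, hg, h.symm, rfl⟩
    · exact Submodule.zero_mem _
  | add q q' hq hq' =>
    rw [add_mul, map_add]
    exact Submodule.add_mem _ hq hq'

/-- The ideal is homogeneous. The claim is proved for all multiples `q * p`, so that the induction
passes through scalar multiplication by polynomials. -/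
lemma homogeneousComponent_mem_idealDegree {p : MvPolynomial (Fin n) ℂ}
    (hp : p ∈ idealJ n k r) (e : ℕ) : homogeneousComponent e p ∈ idealDegree n k r e := by
  suffices h : ∀ q, homogeneousComponent e (q * p) ∈ idealDegree n k r e by
    simpa using h 1
  induction hp using Submodule.span_induction with
  | mem x hx =>
    intro q
    rcases hx with ⟨i, rfl⟩ | ⟨d, h1, h2, rfl⟩
    · exact homogeneousComponent_mul_generator (Or.inl ⟨i, rfl, rfl⟩) q e
    · exact homogeneousComponent_mul_generator (Or.inr ⟨d, h1, h2, rfl, rfl⟩) q e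
  | zero => intro q; rw [mul_zero, map_zero]; exact Submodule.zero_mem _
  | add x y _ _ hx hy =>
    intro q
    rw [mul_add, map_add]
    exact Submodule.add_mem _ (hx q) (hy q)
  | smul s x _ hx =>
    intro q
    rw [smul_eq_mul, ← mul_assoc]
    exact hx (q * s)

lemma map_idealDegree_le (hr : 1 ≤ r) (e : ℕ) :
    (idealDegree n k r e).map (evalPoints n k r) ≤ (lowDegree n e).map (evalPoints n k r) := by
  rw [Submodule.map_le_iff_le_comap]
  refine Submodule.span_le.2 ?_
  rintro _ ⟨b, g, d, hg, rfl, rfl⟩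
  obtain ⟨q, hq, h⟩ := generator_agrees hr hg
  exact ⟨monomial b 1 * q, monomial_mul_mem_lowDegree b hq, (evalPoints_mul_congr _ h).symm⟩

/-- The span of the descent monomials of degree less than `e`. -/
noncomputable def descentBelow (n k r e : ℕ) : Submodule ℂ (MvPolynomial (Fin n) ℂ) :=
  Submodule.span ℂ {p | p ∈ descentMonomials n k r ∧
    ∃ a : Fin n →₀ ℕ, a.degree < e ∧ p = monomial a 1}

lemma descentBelow_mono {d e : ℕ} (h : d ≤ e) : descentBelow n k r d ≤ descentBelow n k r e :=
  Submodule.span_mono fun _ ⟨hp, a, ha, hp'⟩ => ⟨hp, a, ha.trans_le h, hp'⟩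

lemma descentDegree_le_descentBelow {d e : ℕ} (h : d < e) :
    descentDegree n k r d ≤ descentBelow n k r e :=
  Submodule.span_mono fun _ ⟨hp, a, ha, hp'⟩ => ⟨hp, a, ha.trans_lt h, hp'⟩

/-- Straighten each monomial; its ideal part has lower degree after evaluation, so induction on the
degree applies. -/
lemma map_lowDegree_le (hn : 1 ≤ n) (hr : 1 ≤ r) (e : ℕ) :
    (lowDegree n e).map (evalPoints n k r) ≤ (descentBelow n k r e).map (evalPoints n k r) := by
  induction e using Nat.strong_induction_on with
  | _ e ih =>
  rw [Submodule.map_le_iff_le_comap]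
  refine Submodule.span_le.2 ?_
  rintro _ ⟨a, ha, rfl⟩
  have h := Submodule.mem_map_of_mem (f := evalPoints n k r)
    (monomial_mem_descentDegree_sup (k := k) hn hr a)
  rw [Submodule.map_sup] at h
  have h1 := Submodule.map_mono (f := evalPoints n k r)
    (descentDegree_le_descentBelow (n := n) (k := k) (r := r) ha)
  have h2 := (map_idealDegree_le (n := n) (k := k) hr a.degree).trans ((ih _ ha).trans
    (Submodule.map_mono (descentBelow_mono ha.le)))
  exact sup_le h1 h2 h

lemma span_evalPoints_eq_top (hn : 1 ≤ n) (hr : 1 ≤ r) :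
    Submodule.span ℂ (Set.range fun m : descentMonomials n k r => evalPoints n k r m) = ⊤ := by
  have h1 : Set.range (fun m : descentMonomials n k r => evalPoints n k r m)
      = evalPoints n k r '' descentMonomials n k r := by
    ext; simp
  rw [h1, Submodule.span_image, eq_top_iff,
    ← LinearMap.range_eq_top.2 (evalPoints_surjective hr), LinearMap.range_eq_map,
    Submodule.map_le_iff_le_comap]
  intro p _
  rw [p.as_sum]
  refine Submodule.sum_mem _ fun a _ => ?_
  rw [← mul_one (coeff a p), ← smul_eq_mul, ← smul_monomial]
  refine Submodule.smul_mem _ _ ?_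
  have h := map_lowDegree_le (k := k) hn hr (a.degree + 1) (Submodule.mem_map_of_mem
    (monomial_mem_lowDegree (Nat.lt_succ_self _)))
  exact Submodule.map_mono (Submodule.span_mono fun _ hp => hp.1) h

theorem linearIndependent_evalPoints (hn : 1 ≤ n) (hk : k ≤ n) (hr : 1 ≤ r) :
    LinearIndependent ℂ fun m : descentMonomials n k r => evalPoints n k r m := by
  obtain ⟨F, hF⟩ := exists_injective_pointIndex (r := r) hn hk
  have := Finite.of_injective F hF
  have := Fintype.ofFinite (descentMonomials n k r)
  classical
  refine linearIndependent_of_top_le_span_of_card_le_finrank (span_evalPoints_eq_top hn hr).ge ?_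
  rw [Module.finrank_fintype_fun_eq_card]
  exact Fintype.card_le_of_injective F hF

theorem linearIndependent_mk (hn : 1 ≤ n) (hk : k ≤ n) (hr : 1 ≤ r) :
    LinearIndependent ℂ fun m : descentMonomials n k r =>
      (Ideal.Quotient.mk (idealJ n k r) (m : MvPolynomial (Fin n) ℂ) : QuotS n k r) := by
  classical
  obtain ⟨F, hF⟩ := exists_injective_pointIndex (r := r) hn hk
  have := Finite.of_injective F hF
  have := Fintype.ofFinite (descentMonomials n k r)
  have hli := linearIndependent_evalPoints hn hk hr
  choose A hA using fun m : descentMonomials n k r => exists_eq_monomial m.2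
  rw [Fintype.linearIndependent_iff]
  intro c hc m₀
  have hJ : ∑ m, c m • (m : MvPolynomial (Fin n) ℂ) ∈ idealJ n k r := by
    rw [← Ideal.Quotient.eq_zero_iff_mem, ← hc, map_sum]
    rfl
  -- Homogeneity of the ideal allows passing to the component of the relation in the degree of `m₀`.
  set e := (A m₀).degree with he
  have hcomp := homogeneousComponent_mem_idealDegree hJ e
  have hsum : homogeneousComponent e (∑ m, c m • (m : MvPolynomial (Fin n) ℂ))
      = ∑ m, (if (A m).degree = e then c m else 0) • (m : MvPolynomial (Fin n) ℂ) := by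
    rw [map_sum]
    refine Finset.sum_congr rfl fun m _ => ?_
    have h2 : (m : MvPolynomial (Fin n) ℂ).IsHomogeneous (A m).degree := by
      rw [hA m]
      exact isHomogeneous_monomial 1 rfl
    rw [map_smul, homogeneousComponent_of_mem ((mem_homogeneousSubmodule _ _).2 h2)]
    by_cases h : (A m).degree = e
    · rw [if_pos h, if_pos h.symm]
    · rw [if_neg h, if_neg (Ne.symm h), smul_zero, zero_smul]
  rw [hsum] at hcomp
  have hlow := map_lowDegree_le hn hr e (map_idealDegree_le hr e
    (Submodule.mem_map_of_mem (f := evalPoints n k r) hcomp))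
  have hev : evalPoints n k r
      (∑ m, (if (A m).degree = e then c m else 0) • (m : MvPolynomial (Fin n) ℂ))
      = ∑ m, (if (A m).degree = e then c m else 0) • evalPoints n k r m := by
    simp only [map_sum, map_smul]
  rw [hev] at hlow
  have hbelow : (descentBelow n k r e).map (evalPoints n k r)
      ≤ Submodule.span ℂ ((fun m : descentMonomials n k r => evalPoints n k r m) ''
          {m | (A m).degree < e}) := by
    rw [Submodule.map_le_iff_le_comap]
    refine Submodule.span_le.2 ?_
    rintro p ⟨hp, a, ha, hpa⟩
    refine Submodule.subset_span ⟨⟨p, hp⟩, ?_, rfl⟩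
    have h1 : (monomial a (1 : ℂ)) = monomial (A ⟨p, hp⟩) 1 := by rw [← hpa, ← hA]
    change (A ⟨p, hp⟩).degree < e
    rwa [← monomial_left_injective one_ne_zero h1]
  have hdeg : ∑ m, (if (A m).degree = e then c m else 0) • evalPoints n k r m
      ∈ Submodule.span ℂ ((fun m : descentMonomials n k r => evalPoints n k r m) ''
          {m | (A m).degree = e}) := by
    refine Submodule.sum_mem _ fun m _ => ?_
    split_ifs with h
    · exact Submodule.smul_mem _ _ (Submodule.subset_span ⟨m, h, rfl⟩)
    · rw [zero_smul]; exact Submodule.zero_mem _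
  -- The evaluated component lies in the spans of two disjoint subfamilies of an independent family,
  -- degree `e` and degree below `e`, hence is zero.
  have hdisj := hli.disjoint_span_image (s := {m | (A m).degree = e})
    (t := {m | (A m).degree < e})
    (Set.disjoint_left.2 fun m h1 h2 => absurd h1 (ne_of_lt h2))
  have h0 := Submodule.disjoint_def.1 hdisj _ hdeg (hbelow hlow)
  have := Fintype.linearIndependent_iff.1 hli _ h0 m₀
  rwa [if_pos he.symm] at this

theorem span_mk_eq_top (hn : 1 ≤ n) (hr : 1 ≤ r) :
    Submodule.span ℂ (Set.range fun m : descentMonomials n k r =>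
      (Ideal.Quotient.mk (idealJ n k r) (m : MvPolynomial (Fin n) ℂ) : QuotS n k r)) = ⊤ := by
  let f : MvPolynomial (Fin n) ℂ →ₗ[ℂ] QuotS n k r :=
    (Ideal.Quotient.mkₐ ℂ (idealJ n k r)).toLinearMap
  have hf : Function.Surjective f := Ideal.Quotient.mk_surjective
  have h1 : Set.range (fun m : descentMonomials n k r =>
      (Ideal.Quotient.mk (idealJ n k r) (m : MvPolynomial (Fin n) ℂ) : QuotS n k r))
      = f '' descentMonomials n k r := by
    ext x
    simp [f]
  rw [h1, Submodule.span_image, eq_top_iff, ← LinearMap.range_eq_top.2 hf,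
    LinearMap.range_eq_map, Submodule.map_le_iff_le_comap]
  intro p _
  rw [p.as_sum]
  refine Submodule.sum_mem _ fun a _ => ?_
  rw [← mul_one (coeff a p), ← smul_eq_mul, ← smul_monomial]
  refine Submodule.smul_mem _ _ ?_
  obtain ⟨u, hu, v, hv, huv⟩ := Submodule.mem_sup.1
    (monomial_mem_descentDegree_sup (k := k) hn hr a)
  refine ⟨u, Submodule.span_mono (fun _ hp => hp.1) hu, ?_⟩
  have hv0 : f v = 0 := Ideal.Quotient.eq_zero_iff_mem.2 (mem_idealJ_of_mem_idealDegree hv)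
  rw [← huv, map_add, hv0, add_zero]

end Basis

end DescentBasis

/-- The `(n,k)`-descent monomials descend to a basis of `S_{n,k}`: the residue classes of the
elements of the set `D_{n,k}` are linearly independent (in particular pairwise distinct) and
span `S_{n,k}` over `ℂ`. -/
theorem mainTheorem7 (n k r : ℕ) (hn : 1 ≤ n) (hk : k ≤ n) (hr : 1 ≤ r) :
    LinearIndependent ℂ
      (fun m : DescentBasis.descentMonomials n k r =>
        (Ideal.Quotient.mk (DescentBasis.idealJ n k r)
          (m : MvPolynomial (Fin n) ℂ) : DescentBasis.QuotS n k r)) ∧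
    Submodule.span ℂ
      (Set.range fun m : DescentBasis.descentMonomials n k r =>
        (Ideal.Quotient.mk (DescentBasis.idealJ n k r)
          (m : MvPolynomial (Fin n) ℂ) : DescentBasis.QuotS n k r)) = ⊤ :=
  ⟨DescentBasis.linearIndependent_mk hn hk hr, DescentBasis.span_mk_eq_top hn hr⟩
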